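/- Let $\mathbf H,\mathbf E$ be non-zero real $L\times K$ matrices with $d=\operatorname{rank}\mathbf H<\min(L,K)$, and let $\|\cdot\|$ denote the spectral norm. Put $\mathbf A^{(1)}=\mathbf H\mathbf E^{\rm T}+\mathbf E\mathbf H^{\rm T}$, $\mathbf A^{(2)}=\mathbf E\mathbf E^{\rm T}$ and $\mathbf B(\delta)=\delta\mathbf A^{(1)}+\delta^2\mathbf A^{(2)}$, so that $(\mathbf H+\delta\mathbf E)(\mathbf H+\delta\mathbf E)^{\rm T}=\mathbf H\mathbf H^{\rm T}+\mathbf B(\delta)$. Let $\mu_{\min}$ be the smallest positive eigenvalue of $\mathbf H\mathbf H^{\rm T}$, $\mathbf P_0$ the orthogonal projector onto the eigenspace of $\mathbf H\mathbf H^{\rm T}$ for the eigenvalue $0$, $\mathbf P_0^\perp=\mathbf I-\mathbf P_0$, and $\mathbf S_0$ the Moore–Penrose pseudoinverse of $\mathbf H\mathbf H^{\rm T}$. Let $\mathbf P_0^\perp(\delta)$ be the orthogonal projector onto the span of $d$ leading eigenvectors of $(\mathbf H+\delta\mathbf E)(\mathbf H+\delta\mathbf E)^{\rm T}$ (the first $d$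 vectors of an orthonormal eigenbasis ordered by decreasing eigenvalues, counted with multiplicity). Let $\delta_0>0$ and suppose that $\|\mathbf B(\delta)\|/\mu_{\min}<1/4$ for all $\delta\in(-\delta_0,\delta_0)$. Then, for every $\delta\in(-\delta_0,\delta_0)$ and every choice of the leading eigenvectors, $$\big\|\mathbf P_0^\perp(\delta)-\mathbf P_0^\perp-\mathbf W_1(\delta)\big\|\le 16\,C\left(\frac{\|\mathbf B(\delta)\|}{\mu_{\min}}\right)^2\frac{1}{1-4\|\mathbf B(\delta)\|/\mu_{\min}},$$ where $\mathbf W_1(\delta)=\mathbf P_0\mathbf B(\delta)\mathbf S_0+\mathbf S_0\mathbf B(\delta)\mathbf P_0$ and $C=e^{1/6}/\sqrt{\pi}$. -/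

import Mathlib

open scoped InnerProductSpace

noncomputable section

namespace SignalSubspace

/-- A real matrix with `L` rows and `K` columns, regarded as the linear operator it defines from
`ℝ^K` to `ℝ^L` with their Euclidean norms. The norm of this type is the spectral norm, and
`ContinuousLinearMap.adjoint` is transposition. -/
abbrev Op (K L : ℕ) : Type :=
  EuclideanSpace ℝ (Fin K) →L[ℝ] EuclideanSpace ℝ (Fin L)

/-- The transposed operator. -/
abbrev tr {K L : ℕ} (M : Op K L) : Op L K := ContinuousLinearMap.adjoint M

/-- `X` is the Moore-Penrose pseudoinverse of `M` (the four Penrose equations). -/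
structure IsPseudoinverse {K L : ℕ} (M : Op K L) (X : Op L K) : Prop where
  mul_mul_self : M ∘L X ∘L M = M
  self_mul_mul : X ∘L M ∘L X = X
  left_symm : tr (M ∘L X) = M ∘L X
  right_symm : tr (X ∘L M) = X ∘L M

/-- Every symmetric operator is diagonal in an orthonormal basis with decreasing eigenvalues. -/
theorem exists_eigenbasis {L : ℕ} (T : Op L L) (hT : tr T = T) :
    ∃ (u : OrthonormalBasis (Fin L) ℝ (EuclideanSpace ℝ (Fin L))) (ev : Fin L → ℝ),
      Antitone ev ∧ ∀ i, T (u i) = ev i • u i := by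
  have hs : (T : EuclideanSpace ℝ (Fin L) →ₗ[ℝ] EuclideanSpace ℝ (Fin L)).IsSymmetric :=
    ContinuousLinearMap.isSelfAdjoint_iff_isSymmetric.mp hT
  have hn : Module.finrank ℝ (EuclideanSpace ℝ (Fin L)) = L := by simp
  exact ⟨hs.eigenvectorBasis hn, hs.eigenvalues hn, hs.eigenvalues_antitone hn,
    fun i => hs.apply_eigenvectorBasis hn i⟩

theorem exists_symm_pseudoinverse {L : ℕ} (T : Op L L) (hT : tr T = T) :
    ∃ X : Op L L, IsPseudoinverse T X ∧ tr X = X := by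
  obtain ⟨u, ev, -, hu⟩ := exists_eigenbasis T hT
  let X : Op L L := ∑ i, (ev i)⁻¹ • (innerSL ℝ (u i)).smulRight (u i)
  have hX : ∀ j, X (u j) = (ev j)⁻¹ • u j := by
    intro j
    simp [X, u.inner_eq_ite]
  have ext' : ∀ S R : Op L L, (∀ i, S (u i) = R (u i)) → S = R := by
    intro S R h
    apply ContinuousLinearMap.coe_injective
    exact u.toBasis.ext (by simpa using h)
  have symm' : ∀ (S : Op L L) (c : Fin L → ℝ), (∀ i, S (u i) = c i • u i) → tr S = S := by
    intro S c h
    apply ext'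
    intro i
    apply InnerProductSpace.ext_inner_left_basis u.toBasis
    intro j
    rw [ContinuousLinearMap.adjoint_inner_right]
    simp only [OrthonormalBasis.coe_toBasis, h, inner_smul_left, inner_smul_right,
      u.inner_eq_ite]
    by_cases hij : j = i <;> simp [hij]
  refine ⟨X, ⟨?_, ?_, ?_, ?_⟩, symm' X _ hX⟩
  · apply ext'
    intro i
    by_cases h : ev i = 0 <;> simp [hu, hX, h]
  · apply ext'
    intro i
    by_cases h : ev i = 0 <;> simp [hu, hX, h]
  · exact symm' _ (fun i => (ev i)⁻¹ * ev i) (fun i => by simp [hu, hX, smul_smul])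
  · exact symm' _ (fun i => ev i * (ev i)⁻¹) (fun i => by simp [hu, hX, smul_smul])

theorem exists_pseudoinverse {K L : ℕ} (M : Op K L) : ∃ X, IsPseudoinverse M X := by
  have hG : tr (M ∘L tr M) = M ∘L tr M := by
    simp [tr, ContinuousLinearMap.adjoint_comp]
  obtain ⟨Y, hY, hYs⟩ := exists_symm_pseudoinverse (M ∘L tr M) hG
  have key : ∀ D : Op K L, D ∘L tr D = 0 → D = 0 := by
    intro D hD
    have h1 : tr D = 0 := by
      ext1 x
      have h2 := ContinuousLinearMap.adjoint_inner_left D (tr D x) x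
      have h3 : D (tr D x) = 0 := by
        simpa using congrArg (fun S : Op L L => S x) hD
      rw [h3, inner_zero_right] at h2
      simpa using h2
    have h4 : tr (tr D) = 0 := by rw [h1]; simp [tr]
    simpa [tr] using h4
  have hfix : M ∘L tr M ∘L Y ∘L M = M := by
    have h0 : (M ∘L tr M ∘L Y ∘L M - M) = 0 := by
      apply key
      have hD : M ∘L tr M ∘L Y ∘L M - M =
          (((M ∘L tr M) ∘L Y) - ContinuousLinearMap.id ℝ _) ∘L M := by
        ext1 x; simp
      have h5 : (((M ∘L tr M) ∘L Y) - ContinuousLinearMap.id ℝ _) ∘L (M ∘L tr M) = 0 := by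
        have h6 := hY.mul_mul_self
        rw [ContinuousLinearMap.sub_comp, ContinuousLinearMap.id_comp, sub_eq_zero]
        exact h6
      rw [hD]
      show _ ∘L (ContinuousLinearMap.adjoint _) = _
      rw [ContinuousLinearMap.adjoint_comp]
      calc _ = (((((M ∘L tr M) ∘L Y) - ContinuousLinearMap.id ℝ _) ∘L (M ∘L tr M))) ∘L
            tr (((M ∘L tr M) ∘L Y) - ContinuousLinearMap.id ℝ _) := rfl
        _ = 0 := by rw [h5, ContinuousLinearMap.zero_comp]
    exact sub_eq_zero.mp h0
  refine ⟨tr M ∘L Y, ⟨hfix, ?_, hY.left_symm, ?_⟩⟩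
  · calc _ = tr M ∘L (Y ∘L (M ∘L tr M) ∘L Y) := rfl
      _ = _ := by rw [hY.self_mul_mul]
  · have hYs' : ContinuousLinearMap.adjoint Y = Y := hYs
    simp only [tr, ContinuousLinearMap.adjoint_comp, ContinuousLinearMap.adjoint_adjoint, hYs']
    rfl

/-- The Moore-Penrose pseudoinverse. -/
def pinv {K L : ℕ} (M : Op K L) : Op L K := Classical.choose (exists_pseudoinverse M)

/-- The defining property of `pinv`. -/
theorem pinv_spec {K L : ℕ} (M : Op K L) : IsPseudoinverse M (pinv M) :=
  Classical.choose_spec (exists_pseudoinverse M)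

/-- The operator `M Mᵀ`. -/
def gram {K L : ℕ} (M : Op K L) : Op L L := M ∘L tr M

/-- `A⁽¹⁾ = H Eᵀ + E Hᵀ`. -/
def A1 {K L : ℕ} (H E : Op K L) : Op L L := H ∘L tr E + E ∘L tr H

/-- `A⁽²⁾ = E Eᵀ`. -/
def A2 {K L : ℕ} (E : Op K L) : Op L L := E ∘L tr E

/-- The perturbation `B(δ) = δ A⁽¹⁾ + δ² A⁽²⁾`. -/
def B {K L : ℕ} (H E : Op K L) (δ : ℝ) : Op L L := δ • A1 H E + δ ^ 2 • A2 E

/-- The smallest positive eigenvalue of `H Hᵀ`. -/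
def muMin {K L : ℕ} (H : Op K L) : ℝ :=
  sInf {μ : ℝ | 0 < μ ∧ Module.End.HasEigenvalue
    (gram H : EuclideanSpace ℝ (Fin L) →ₗ[ℝ] EuclideanSpace ℝ (Fin L)) μ}

/-- The eigenspace of `H Hᵀ` for the eigenvalue `0`. -/
def U0 {K L : ℕ} (H : Op K L) : Submodule ℝ (EuclideanSpace ℝ (Fin L)) :=
  Module.End.eigenspace
    (gram H : EuclideanSpace ℝ (Fin L) →ₗ[ℝ] EuclideanSpace ℝ (Fin L)) 0

/-- The orthogonal projector onto `U0`. -/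
def P0 {K L : ℕ} (H : Op K L) : Op L L := (U0 H).starProjection

/-- The orthogonal projector onto the signal subspace. -/
def P0perp {K L : ℕ} (H : Op K L) : Op L L := ContinuousLinearMap.id ℝ _ - P0 H

/-- The pseudoinverse of `H Hᵀ`. -/
def S0 {K L : ℕ} (H : Op K L) : Op L L := pinv (gram H)

/-- The first term `W₁(δ) = P₀ B(δ) S₀ + S₀ B(δ) P₀` of the perturbation expansion. -/
def W1 {K L : ℕ} (H E : Op K L) (δ : ℝ) : Op L L :=
  P0 H ∘L B H E δ ∘L S0 H + S0 H ∘L B H E δ ∘L P0 H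

/-- The rank of `H`. -/
def rank {K L : ℕ} (H : Op K L) : ℕ :=
  Module.finrank ℝ (LinearMap.range
    (H : EuclideanSpace ℝ (Fin K) →ₗ[ℝ] EuclideanSpace ℝ (Fin L)))

/-- `U` is spanned by `d` leading eigenvectors of `T`: the first `d` vectors of an orthonormal
eigenbasis, ordered so that the eigenvalues (with multiplicities) decrease. -/
def IsLeadingEigenspan {L : ℕ} (T : Op L L) (d : ℕ)
    (U : Submodule ℝ (EuclideanSpace ℝ (Fin L))) : Prop :=
  ∃ (u : OrthonormalBasis (Fin L) ℝ (EuclideanSpace ℝ (Fin L))) (ev : Fin L → ℝ),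
    Antitone ev ∧ (∀ i, T (u i) = ev i • u i) ∧
      U = Submodule.span ℝ (u '' {i : Fin L | (i : ℕ) < d})

/-- Such a `U` exists for `T = M Mᵀ`. -/
theorem exists_isLeadingEigenspan {K L : ℕ} (M : Op K L) (d : ℕ) :
    ∃ U, IsLeadingEigenspan (gram M) d U := by
  obtain ⟨u, ev, h1, h2⟩ := exists_eigenbasis (gram M)
    (by simp [gram, tr, ContinuousLinearMap.adjoint_comp])
  exact ⟨_, u, ev, h1, h2, rfl⟩

end SignalSubspace

end

namespace SignalSubspace

/-! ### Second-order perturbation of complementary projections in a normed ring -/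

section NormedRing

variable {A : Type*} [NormedRing A] {G V P Q S P' Q' R : A} {b μ : ℝ}

/-! The proof is purely algebraic and needs no contour integral or power series. Write `G` for `gram
H`, `V` for the perturbation, `P`, `Q` for the projectors onto the range and kernel of `G`, `P'`,
`Q'` for the perturbed pair, and `b = ‖V‖`, `μ = muMin H`, `β = b / μ`.

A dimension count in the style of Weyl's inequality (`muMin_sub_le_eigenvalue`,
`eigenvalue_le_norm`) shows that `G + V` is at least `μ - b` on the range of `P'` and lies between
`0` and `b` on the range of `Q'`. Hence the mixed products `QP'`, `P'Q`, `PQ'`, `Q'P` have norm at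
most `b / (μ - b)`.

Split `P' - P` into blocks with respect to `P + Q = 1`. The diagonal blocks `QP'Q` and `-PQ'P` are
products of two mixed products, hence quadratic. The off-diagonal blocks equal `QVS` and `SVQ` up to
four terms, each a mixed product times `V` and `S`. This is `norm_projection_sub_first_order_le`;
`second_order_bound_le` shows that its bound, at most `6β² / (1 - 4β)`, lies below the one required.
-/

theorem norm_mul_mul_le_of_le {x y z : A} {p q r : ℝ} (hx : ‖x‖ ≤ p) (hy : ‖y‖ ≤ q)
    (hz : ‖z‖ ≤ r) : ‖x * y * z‖ ≤ p * q * r :=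
  (norm_mul_le _ _).trans
    (mul_le_mul ((norm_mul_le _ _).trans (mul_le_mul hx hy (norm_nonneg _)
      ((norm_nonneg _).trans hx))) hz (norm_nonneg _)
      (mul_nonneg ((norm_nonneg _).trans hx) ((norm_nonneg _).trans hy)))

/-- A solution of `X = S (X M - V)` with `‖S‖ ≤ 1 / μ` and `‖M‖, ‖V‖ ≤ b < μ` is small. -/
theorem le_div_sub_of_le_mul {x : ℝ} (hμ : 0 < μ) (hb : b < μ) (h : x ≤ 1 / μ * (x * b + b)) :
    x ≤ b / (μ - b) := by
  rw [le_div_iff₀ (by linarith)]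
  have h1 : μ * x ≤ μ * (1 / μ * (x * b + b)) := mul_le_mul_of_nonneg_left h hμ.le
  rw [← mul_assoc, mul_one_div_cancel hμ.ne'] at h1
  linarith

/-- Perturbation of a spectral projection to second order: `P` is the projection for `G` that is
complementary to its kernel projection `Q`, and `P'` is the one for `G + V`. -/
theorem norm_projection_sub_first_order_le
    (hμ : 0 < μ) (hb : b < μ) (hV : ‖V‖ ≤ b)
    (hPQ : P + Q = 1) (hPQ' : P' + Q' = 1) (hPP : P * P = P) (hPP' : P' * P' = P')
    (hQ : ‖Q‖ ≤ 1) (hQ' : ‖Q'‖ ≤ 1)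
    (hSG : S * G = P) (hGS : G * S = P) (hPS : P * S = S) (hSP : S * P = S)
    (hQG : Q * G = 0) (hGQ : G * Q = 0) (hS : ‖S‖ ≤ 1 / μ)
    (hcomm : (G + V) * P' = P' * (G + V)) (hTQ : ‖(G + V) * Q'‖ ≤ b)
    (hTR : (G + V) * R = P') (hRT : R * (G + V) = P') (hR : ‖R‖ ≤ 1 / (μ - b)) :
    ‖P' - P - (Q * V * S + S * V * Q)‖ ≤
      2 * (b / (μ - b)) ^ 2 + 4 * (b / (μ - b) * (b / μ)) := by
  have hb0 : 0 ≤ b := (norm_nonneg _).trans hV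
  have hQe : Q = 1 - P := by rw [← hPQ]; abel
  have hQe' : Q' = 1 - P' := by rw [← hPQ']; abel
  have hQQ' : Q' * Q' = Q' := by rw [hQe']; simp [mul_sub, sub_mul, hPP']
  have hQS : Q * S = 0 := by rw [hQe, sub_mul, hPS, one_mul, sub_self]
  have hSQ : S * Q = 0 := by rw [hQe, mul_sub, hSP, mul_one, sub_self]
  have hcommQ : (G + V) * Q' = Q' * (G + V) := by rw [hQe', mul_sub, sub_mul, hcomm]; simp
  -- Since `Q` kills `G`, only `V` survives when `P'` is written as `(G + V) R`.
  have hQP' : ‖Q * P'‖ ≤ b / (μ - b) := by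
    have : Q * P' = Q * V * R := by rw [← hTR, ← mul_assoc, mul_add, hQG, zero_add]
    rw [this]
    exact (norm_mul_mul_le_of_le hQ hV hR).trans_eq (by ring)
  have hP'Q : ‖P' * Q‖ ≤ b / (μ - b) := by
    have : P' * Q = R * V * Q := by rw [← hRT, mul_assoc, add_mul, hGQ, zero_add, mul_assoc]
    rw [this]
    exact (norm_mul_mul_le_of_le hR hV hQ).trans_eq (by ring)
  -- `P * Q'` satisfies a Sylvester-type equation: `S` has norm at most `1 / μ` and `(G + V) * Q'`
  -- at most `b < μ`, so the occurrence on the right can be absorbed.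
  have hPQn : ‖P * Q'‖ ≤ b / (μ - b) := by
    apply le_div_sub_of_le_mul hμ hb
    have h1 : P * Q' = S * (P * Q' * ((G + V) * Q') - V * Q') := by
      have h2 : P * Q' * ((G + V) * Q') = P * ((G + V) * Q') := by
        rw [hcommQ, mul_assoc, ← mul_assoc Q' Q', hQQ']
      rw [h2, mul_sub, ← mul_assoc S P, hSP, ← hSG]
      noncomm_ring
    have h3 : ‖P * Q' * ((G + V) * Q') - V * Q'‖ ≤ ‖P * Q'‖ * b + b := by
      refine (norm_sub_le _ _).trans (add_le_add ?_ ?_)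
      · exact (norm_mul_le _ _).trans (by gcongr)
      · exact ((norm_mul_le _ _).trans (mul_le_mul hV hQ' (norm_nonneg _) hb0)).trans_eq
          (mul_one b)
    calc ‖P * Q'‖ = ‖S * (P * Q' * ((G + V) * Q') - V * Q')‖ := congrArg _ h1
      _ ≤ _ := (norm_mul_le _ _).trans (by gcongr)
  have hQPn : ‖Q' * P‖ ≤ b / (μ - b) := by
    apply le_div_sub_of_le_mul hμ hb
    have h1 : Q' * P = ((G + V) * Q' * (Q' * P) - Q' * V) * S := by
      have h2 : (G + V) * Q' * (Q' * P) = (G + V) * Q' * P := by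
        rw [mul_assoc, ← mul_assoc Q' Q', hQQ', mul_assoc]
      rw [h2, sub_mul, mul_assoc _ P S, hPS, ← hGS, hcommQ]
      noncomm_ring
    have h3 : ‖(G + V) * Q' * (Q' * P) - Q' * V‖ ≤ ‖Q' * P‖ * b + b := by
      refine (norm_sub_le _ _).trans (add_le_add ?_ ?_)
      · exact (norm_mul_le _ _).trans ((mul_comm _ _).trans_le (by gcongr))
      · exact ((norm_mul_le _ _).trans (mul_le_mul hQ' hV (norm_nonneg _) zero_le_one)).trans_eq
          (one_mul b)
    calc ‖Q' * P‖ = ‖((G + V) * Q' * (Q' * P) - Q' * V) * S‖ := congrArg _ h1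
      _ ≤ _ := (norm_mul_le _ _).trans ((mul_comm _ _).trans_le (by gcongr))
  have hx0 : 0 ≤ b / (μ - b) := (norm_nonneg _).trans hQPn
  -- Replace `P` by `((G + V) - V) S`, commute `G + V` past `P'` until `Q` kills `G`, then put `P' =
  -- 1 - Q'` to isolate the first-order term.
  have e1 : Q * P' * P = Q * V * S - Q * V * (Q' * P) * S - Q * P' * (V * S) := by
    have h1 : Q * P' * (G + V) = Q * V * P' := by
      rw [mul_assoc, ← hcomm, ← mul_assoc, mul_add, hQG, zero_add]
    have h2 : Q * P' * P = Q * P' * (G + V) * S - Q * P' * (V * S) := by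
      rw [← hGS]; noncomm_ring
    have h3 : Q * V * (Q' * P) * S = Q * V * S - Q * V * P' * S := by
      rw [mul_assoc, mul_assoc Q' P S, hPS, hQe']; noncomm_ring
    rw [h2, h1, h3]; abel
  have e2 : P * P' * Q = S * V * Q - S * (P * Q') * (V * Q) - S * V * (P' * Q) := by
    have h1 : (G + V) * (P' * Q) = P' * (V * Q) := by
      rw [← mul_assoc, hcomm, mul_assoc, add_mul, hGQ, zero_add]
    have h2 : P * P' * Q = S * ((G + V) * (P' * Q)) - S * V * (P' * Q) := by
      rw [← hSG]; noncomm_ring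
    have h3 : S * (P * Q') * (V * Q) = S * V * Q - S * (P' * (V * Q)) := by
      rw [← mul_assoc S P, hSP, hQe']; noncomm_ring
    rw [h2, h1, h3]; abel
  -- Block decomposition of `P' - P`; idempotence of `P'` and `Q'` factors the diagonal blocks into
  -- pairs of small factors.
  have e3 : P' - P - (Q * V * S + S * V * Q) =
      Q * P' * (P' * Q) - P * Q' * (Q' * P)
        - (Q * V * (Q' * P) * S + Q * P' * (V * S))
        - (S * (P * Q') * (V * Q) + S * V * (P' * Q)) := by
    have h1 : Q * P' * (P' * Q) = Q * P' * Q := by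
      rw [mul_assoc, ← mul_assoc P' P', hPP', mul_assoc]
    have h2 : P * Q' * (Q' * P) = P - P * P' * P := by
      rw [mul_assoc, ← mul_assoc Q' Q', hQQ', hQe']
      simp [mul_sub, sub_mul, hPP, mul_assoc]
    have h3 : P' = (P + Q) * P' * (P + Q) := by rw [hPQ]; simp
    have h4 : P' = P * P' * P + P * P' * Q + Q * P' * P + Q * P' * Q := by
      conv_lhs => rw [h3]
      noncomm_ring
    have h5 : Q * V * (Q' * P) * S + Q * P' * (V * S) = Q * V * S - Q * P' * P := by
      rw [e1]; abel
    have h6 : S * (P * Q') * (V * Q) + S * V * (P' * Q) = S * V * Q - P * P' * Q := by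
      rw [e2]; abel
    rw [h1, h2, h5, h6]
    conv_lhs => rw [h4]
    abel
  have hVS : ‖V * S‖ ≤ b * (1 / μ) :=
    (norm_mul_le _ _).trans (mul_le_mul hV hS (norm_nonneg _) hb0)
  have hSV : ‖S * V‖ ≤ 1 / μ * b :=
    (norm_mul_le _ _).trans (mul_le_mul hS hV (norm_nonneg _) (by positivity))
  have hVQ : ‖V * Q‖ ≤ b :=
    ((norm_mul_le _ _).trans (mul_le_mul hV hQ (norm_nonneg _) hb0)).trans_eq (mul_one b)
  have hQV : ‖Q * V‖ ≤ b :=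
    ((norm_mul_le _ _).trans (mul_le_mul hQ hV (norm_nonneg _) zero_le_one)).trans_eq (one_mul b)
  have n1 : ‖Q * P' * (P' * Q)‖ ≤ b / (μ - b) * (b / (μ - b)) :=
    (norm_mul_le _ _).trans (mul_le_mul hQP' hP'Q (norm_nonneg _) hx0)
  have n2 : ‖P * Q' * (Q' * P)‖ ≤ b / (μ - b) * (b / (μ - b)) :=
    (norm_mul_le _ _).trans (mul_le_mul hPQn hQPn (norm_nonneg _) hx0)
  have n3 : ‖Q * V * (Q' * P) * S‖ ≤ b * (b / (μ - b)) * (1 / μ) :=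
    norm_mul_mul_le_of_le hQV hQPn hS
  have n4 : ‖Q * P' * (V * S)‖ ≤ b / (μ - b) * (b * (1 / μ)) :=
    (norm_mul_le _ _).trans (mul_le_mul hQP' hVS (norm_nonneg _) hx0)
  have n5 : ‖S * (P * Q') * (V * Q)‖ ≤ 1 / μ * (b / (μ - b)) * b :=
    norm_mul_mul_le_of_le hS hPQn hVQ
  have n6 : ‖S * V * (P' * Q)‖ ≤ 1 / μ * b * (b / (μ - b)) :=
    (norm_mul_le _ _).trans (mul_le_mul hSV hP'Q (norm_nonneg _) (by positivity))
  rw [e3]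
  calc _ ≤ (b / (μ - b) * (b / (μ - b)) + b / (μ - b) * (b / (μ - b))
        + (b * (b / (μ - b)) * (1 / μ) + b / (μ - b) * (b * (1 / μ))))
        + (1 / μ * (b / (μ - b)) * b + 1 / μ * b * (b / (μ - b))) :=
        (norm_sub_le _ _).trans (add_le_add ((norm_sub_le _ _).trans (add_le_add
          ((norm_sub_le _ _).trans (add_le_add n1 n2))
          ((norm_add_le _ _).trans (add_le_add n3 n4))))
          ((norm_add_le _ _).trans (add_le_add n5 n6)))
    _ = _ := by ring

end NormedRing

/-- The numerical comparison that turns the second-order estimate into the stated bound. -/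
theorem second_order_bound_le {b μ : ℝ} (hμ : 0 < μ) (hb0 : 0 ≤ b) (hb : b / μ < 1 / 4) :
    2 * (b / (μ - b)) ^ 2 + 4 * (b / (μ - b) * (b / μ)) ≤
      16 * (Real.exp (1 / 6) / Real.sqrt Real.pi) * (b / μ) ^ 2 * (1 / (1 - 4 * (b / μ))) := by
  -- A crude bound is enough: the comparison below only needs `6 ≤ 16 C`.
  have hC : 1 / 2 ≤ Real.exp (1 / 6) / Real.sqrt Real.pi := by
    have h1 : Real.sqrt Real.pi ≤ 2 := by
      rw [Real.sqrt_le_left (by norm_num)]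
      linarith [Real.pi_le_four]
    have h2 : (1 : ℝ) ≤ Real.exp (1 / 6) := Real.one_le_exp (by norm_num)
    have h3 : 0 < Real.sqrt Real.pi := Real.sqrt_pos.2 Real.pi_pos
    rw [le_div_iff₀ h3]
    linarith
  set β := b / μ with hβ
  have hβ0 : 0 ≤ β := div_nonneg hb0 hμ.le
  have hx : b / (μ - b) = β * (1 / (1 - β)) := by
    have hbe : b = β * μ := by rw [hβ]; field_simp
    have h1 : (1 - β) ≠ 0 := by linarith
    rw [hbe, show μ - β * μ = (1 - β) * μ by ring]
    field_simp
  have h4 : 0 < 1 - 4 * β := by linarith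
  have h5 : (1 / (1 - β)) ^ 2 ≤ 1 / (1 - 4 * β) := by
    rw [div_pow, one_pow]
    exact one_div_le_one_div_of_le h4 (by nlinarith)
  have h6 : 1 / (1 - β) ≤ 1 / (1 - 4 * β) := one_div_le_one_div_of_le h4 (by linarith)
  rw [hx]
  calc _ = β ^ 2 * (2 * (1 / (1 - β)) ^ 2 + 4 * (1 / (1 - β))) := by ring
    _ ≤ β ^ 2 * (2 * (1 / (1 - 4 * β)) + 4 * (1 / (1 - 4 * β))) := by gcongr
    _ = 6 * β ^ 2 * (1 / (1 - 4 * β)) := by ring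
    _ ≤ _ := by
      gcongr
      linarith

/-! ### Operators diagonal in an orthonormal basis -/

section Diagonal

variable {L : ℕ} {u : OrthonormalBasis (Fin L) ℝ (EuclideanSpace ℝ (Fin L))} {c : Fin L → ℝ}
  {T : Op L L}

theorem inner_apply_of_diagonal (hT : ∀ i, T (u i) = c i • u i)
    (i : Fin L) (x : EuclideanSpace ℝ (Fin L)) : ⟪u i, T x⟫_ℝ = c i * ⟪u i, x⟫_ℝ := by
  conv_lhs => rw [← u.sum_repr' x]
  simp [hT, inner_sum, inner_smul_right, u.inner_eq_ite, mul_comm]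

theorem op_ext_of_basis {S R : Op L L} (h : ∀ i, S (u i) = R (u i)) : S = R := by
  apply ContinuousLinearMap.coe_injective
  exact u.toBasis.ext (by simpa using h)

theorem exists_diagonal (u : OrthonormalBasis (Fin L) ℝ (EuclideanSpace ℝ (Fin L)))
    (c : Fin L → ℝ) : ∃ X : Op L L, ∀ i, X (u i) = c i • u i :=
  ⟨∑ i, c i • (innerSL ℝ (u i)).smulRight (u i), fun j => by simp [u.inner_eq_ite]⟩

theorem norm_le_of_diagonal {m : ℝ} (hm : 0 ≤ m) (hT : ∀ i, T (u i) = c i • u i)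
    (hc : ∀ i, |c i| ≤ m) : ‖T‖ ≤ m := by
  refine T.opNorm_le_bound hm fun x => ?_
  refine le_of_sq_le_sq ?_ (by positivity)
  rw [mul_pow, ← u.sum_sq_norm_inner_right (T x), ← u.sum_sq_norm_inner_right x, Finset.mul_sum]
  refine Finset.sum_le_sum fun i _ => ?_
  rw [inner_apply_of_diagonal hT, norm_mul, mul_pow]
  have := hc i
  rw [Real.norm_eq_abs (c i)]
  gcongr

theorem inner_apply_self_eq_sum (hT : ∀ i, T (u i) = c i • u i)
    (x : EuclideanSpace ℝ (Fin L)) : ⟪x, T x⟫_ℝ = ∑ i, c i * ⟪u i, x⟫_ℝ ^ 2 := by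
  rw [← u.sum_inner_mul_inner x (T x)]
  refine Finset.sum_congr rfl fun i _ => ?_
  rw [inner_apply_of_diagonal hT, real_inner_comm]
  ring

theorem norm_sq_eq_sum (u : OrthonormalBasis (Fin L) ℝ (EuclideanSpace ℝ (Fin L)))
    (x : EuclideanSpace ℝ (Fin L)) : ‖x‖ ^ 2 = ∑ i, ⟪u i, x⟫_ℝ ^ 2 := by
  rw [← u.sum_sq_norm_inner_right x]
  simp

theorem inner_eq_zero_of_mem_span {s : Set (Fin L)} {x : EuclideanSpace ℝ (Fin L)}
    (hx : x ∈ Submodule.span ℝ (u '' s)) {j : Fin L} (hj : j ∉ s) : ⟪u j, x⟫_ℝ = 0 := by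
  induction hx using Submodule.span_induction with
  | mem x h =>
    obtain ⟨i, hi, rfl⟩ := h
    rw [u.inner_eq_ite, if_neg]
    rintro rfl
    exact hj hi
  | zero => simp
  | add x y _ _ h1 h2 => simp [inner_add_right, h1, h2]
  | smul a x _ h => simp [inner_smul_right, h]

theorem inner_apply_self_le_of_mem_span (hT : ∀ i, T (u i) = c i • u i) {s : Set (Fin L)} {m : ℝ}
    (hc : ∀ i ∈ s, c i ≤ m) {x : EuclideanSpace ℝ (Fin L)}
    (hx : x ∈ Submodule.span ℝ (u '' s)) : ⟪x, T x⟫_ℝ ≤ m * ‖x‖ ^ 2 := by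
  rw [inner_apply_self_eq_sum hT, norm_sq_eq_sum u, Finset.mul_sum]
  refine Finset.sum_le_sum fun i _ => ?_
  by_cases hi : i ∈ s
  · exact mul_le_mul_of_nonneg_right (hc i hi) (sq_nonneg _)
  · simp [inner_eq_zero_of_mem_span hx hi]

theorem le_inner_apply_self_of_mem_span (hT : ∀ i, T (u i) = c i • u i) {s : Set (Fin L)} {m : ℝ}
    (hc : ∀ i ∈ s, m ≤ c i) {x : EuclideanSpace ℝ (Fin L)}
    (hx : x ∈ Submodule.span ℝ (u '' s)) : m * ‖x‖ ^ 2 ≤ ⟪x, T x⟫_ℝ := by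
  rw [inner_apply_self_eq_sum hT, norm_sq_eq_sum u, Finset.mul_sum]
  refine Finset.sum_le_sum fun i _ => ?_
  by_cases hi : i ∈ s
  · exact mul_le_mul_of_nonneg_right (hc i hi) (sq_nonneg _)
  · simp [inner_eq_zero_of_mem_span hx hi]

/-- The dimensions add up to more than `L`, so the subspaces must meet; this supplies the test
vectors for the eigenvalue bounds. -/
theorem exists_ne_zero_mem_inf_span (u : OrthonormalBasis (Fin L) ℝ (EuclideanSpace ℝ (Fin L)))
    (W : Submodule ℝ (EuclideanSpace ℝ (Fin L))) (s : Finset (Fin L))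
    (h : L < Module.finrank ℝ W + s.card) :
    ∃ x ≠ 0, x ∈ W ∧ x ∈ Submodule.span ℝ (u '' (s : Set (Fin L))) := by
  have h1 : Module.finrank ℝ (Submodule.span ℝ (u '' (s : Set (Fin L)))) = s.card := by
    have h2 := finrank_span_eq_card (R := ℝ)
      (u.orthonormal.linearIndependent.comp ((↑) : s → Fin L) Subtype.val_injective)
    rw [Set.range_comp, Subtype.range_coe_subtype, Fintype.card_coe] at h2
    exact h2
  have h3 := Submodule.finrank_sup_add_finrank_inf_eq W (Submodule.span ℝ (u '' (s : Set (Fin L))))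
  have h4 := Submodule.finrank_le (W ⊔ Submodule.span ℝ (u '' (s : Set (Fin L))))
  rw [finrank_euclideanSpace_fin] at h4
  have h5 : W ⊓ Submodule.span ℝ (u '' (s : Set (Fin L))) ≠ ⊥ := by
    intro h6
    rw [h6, finrank_bot] at h3
    omega
  obtain ⟨x, hx, hx0⟩ := Submodule.exists_mem_ne_zero_of_ne_bot h5
  exact ⟨x, hx0, hx.1, hx.2⟩

theorem starProjection_span_apply (s : Set (Fin L)) [DecidablePred (· ∈ s)] (i : Fin L) :
    (Submodule.span ℝ (u '' s)).starProjection (u i) = (if i ∈ s then (1 : ℝ) else 0) • u i := by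
  by_cases hi : i ∈ s
  · rw [if_pos hi, one_smul, Submodule.starProjection_eq_self_iff]
    exact Submodule.subset_span ⟨i, hi, rfl⟩
  · rw [if_neg hi, zero_smul, Submodule.starProjection_apply_eq_zero_iff,
      Submodule.mem_orthogonal']
    exact fun x hx => inner_eq_zero_of_mem_span hx hi

end Diagonal

/-! ### Kernel, range and spectral gap of `gram H` -/

section Gram

variable {K L : ℕ}

theorem tr_gram (H : Op K L) : tr (gram H) = gram H := by
  simp [gram, tr, ContinuousLinearMap.adjoint_comp]

theorem gram_add_smul (H E : Op K L) (δ : ℝ) : gram (H + δ • E) = gram H + B H E δ := by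
  ext1 x
  simp [gram, B, A1, A2, tr, map_add, smul_add, smul_smul, pow_two]
  abel

theorem inner_gram_self (H : Op K L) (x : EuclideanSpace ℝ (Fin L)) :
    ⟪x, gram H x⟫_ℝ = ‖tr H x‖ ^ 2 := by
  rw [← real_inner_self_eq_norm_sq, tr, ContinuousLinearMap.adjoint_inner_left]
  rfl

theorem inner_gram_comm (H : Op K L) (x y : EuclideanSpace ℝ (Fin L)) :
    ⟪gram H x, y⟫_ℝ = ⟪x, gram H y⟫_ℝ := by
  conv_lhs => rw [← tr_gram H]
  exact ContinuousLinearMap.adjoint_inner_left _ _ _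

theorem mem_U0 {H : Op K L} {x : EuclideanSpace ℝ (Fin L)} : x ∈ U0 H ↔ gram H x = 0 := by
  simp [U0]

theorem mem_U0_iff_tr {H : Op K L} {x : EuclideanSpace ℝ (Fin L)} : x ∈ U0 H ↔ tr H x = 0 := by
  rw [mem_U0]
  constructor
  · intro h
    have := inner_gram_self H x
    rw [h, inner_zero_right] at this
    simpa using this.symm
  · intro h
    simp [gram, h]

theorem U0_eq_orthogonal_range (H : Op K L) :
    U0 H = (LinearMap.range (H : EuclideanSpace ℝ (Fin K) →ₗ[ℝ] EuclideanSpace ℝ (Fin L)))ᗮ := by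
  rw [ContinuousLinearMap.orthogonal_range]
  ext x
  rw [mem_U0_iff_tr]
  rfl

theorem rank_add_finrank_U0 (H : Op K L) : rank H + Module.finrank ℝ (U0 H) = L := by
  rw [U0_eq_orthogonal_range, rank, Submodule.finrank_add_finrank_orthogonal,
    finrank_euclideanSpace_fin]

theorem finrank_orthogonal_U0 (H : Op K L) : Module.finrank ℝ (U0 H)ᗮ = rank H := by
  have h1 := rank_add_finrank_U0 H
  have h2 := Submodule.finrank_add_finrank_orthogonal (U0 H)
  rw [finrank_euclideanSpace_fin] at h2
  omega

theorem gram_ne_zero {H : Op K L} (hH : H ≠ 0) : gram H ≠ 0 := by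
  intro h
  apply hH
  have h1 : tr H = 0 := by
    ext1 x
    exact mem_U0_iff_tr.1 (mem_U0.2 (by rw [h]; rfl))
  have h2 : tr (tr H) = 0 := by rw [h1]; simp [tr]
  simpa [tr] using h2

theorem eigenvalue_gram_nonneg {H : Op K L}
    {u : OrthonormalBasis (Fin L) ℝ (EuclideanSpace ℝ (Fin L))} {ev : Fin L → ℝ}
    (hu : ∀ i, gram H (u i) = ev i • u i) (i : Fin L) : 0 ≤ ev i := by
  have h := inner_gram_self H (u i)
  rw [hu, inner_smul_right, real_inner_self_eq_norm_sq, u.norm_eq_one] at h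
  rw [one_pow, mul_one] at h
  rw [h]
  positivity

theorem hasEigenvalue_of_diagonal {T : Op L L}
    {u : OrthonormalBasis (Fin L) ℝ (EuclideanSpace ℝ (Fin L))} {ev : Fin L → ℝ}
    (hu : ∀ i, T (u i) = ev i • u i) (i : Fin L) :
    Module.End.HasEigenvalue
      (T : EuclideanSpace ℝ (Fin L) →ₗ[ℝ] EuclideanSpace ℝ (Fin L)) (ev i) :=
  Module.End.hasEigenvalue_of_hasEigenvector (x := u i)
    ⟨Module.End.mem_eigenspace_iff.2 (hu i), u.orthonormal.ne_zero i⟩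

theorem muMin_pos {H : Op K L} (hH : H ≠ 0) : 0 < muMin H := by
  obtain ⟨u, ev, -, hu⟩ := exists_eigenbasis (gram H) (tr_gram H)
  have hne : {μ : ℝ | 0 < μ ∧ Module.End.HasEigenvalue
      (gram H : EuclideanSpace ℝ (Fin L) →ₗ[ℝ] EuclideanSpace ℝ (Fin L)) μ}.Nonempty := by
    by_contra h
    apply gram_ne_zero hH
    apply op_ext_of_basis (u := u)
    intro i
    have h1 : ev i = 0 := by
      by_contra h2
      exact h ⟨ev i, lt_of_le_of_ne (eigenvalue_gram_nonneg hu i) (Ne.symm h2),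
        hasEigenvalue_of_diagonal hu i⟩
    simp [hu, h1]
  -- Finiteness makes the infimum attained, hence itself positive.
  have hfin : {μ : ℝ | 0 < μ ∧ Module.End.HasEigenvalue
      (gram H : EuclideanSpace ℝ (Fin L) →ₗ[ℝ] EuclideanSpace ℝ (Fin L)) μ}.Finite :=
    (Module.End.finite_hasEigenvalue _).subset fun _ h => h.2
  exact (hne.csInf_mem hfin).1

theorem mem_span_of_mem_orthogonal_U0 {H : Op K L}
    {u : OrthonormalBasis (Fin L) ℝ (EuclideanSpace ℝ (Fin L))} {ev : Fin L → ℝ}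
    (hu : ∀ i, gram H (u i) = ev i • u i) {x : EuclideanSpace ℝ (Fin L)} (hx : x ∈ (U0 H)ᗮ) :
    x ∈ Submodule.span ℝ (u '' {i | ev i ≠ 0}) := by
  rw [← u.sum_repr' x]
  refine Submodule.sum_mem _ fun i _ => ?_
  by_cases hi : ev i = 0
  · rw [(Submodule.mem_orthogonal _ _).1 hx (u i) (mem_U0.2 (by simp [hu, hi])), zero_smul]
    exact Submodule.zero_mem _
  · exact Submodule.smul_mem _ _ (Submodule.subset_span ⟨i, hi, rfl⟩)

theorem muMin_mul_le_inner {H : Op K L} {x : EuclideanSpace ℝ (Fin L)} (hx : x ∈ (U0 H)ᗮ) :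
    muMin H * ‖x‖ ^ 2 ≤ ⟪x, gram H x⟫_ℝ := by
  obtain ⟨u, ev, -, hu⟩ := exists_eigenbasis (gram H) (tr_gram H)
  refine le_inner_apply_self_of_mem_span hu (fun i hi => ?_) (mem_span_of_mem_orthogonal_U0 hu hx)
  exact csInf_le ⟨0, fun y hy => hy.1.le⟩
    ⟨lt_of_le_of_ne (eigenvalue_gram_nonneg hu i) (Ne.symm hi), hasEigenvalue_of_diagonal hu i⟩

theorem muMin_mul_norm_le {H : Op K L} {x : EuclideanSpace ℝ (Fin L)} (hx : x ∈ (U0 H)ᗮ) :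
    muMin H * ‖x‖ ≤ ‖gram H x‖ := by
  rcases eq_or_ne x 0 with rfl | h0
  · simp
  have h1 : muMin H * ‖x‖ * ‖x‖ ≤ ‖gram H x‖ * ‖x‖ := by
    calc _ = muMin H * ‖x‖ ^ 2 := by ring
      _ ≤ ⟪x, gram H x⟫_ℝ := muMin_mul_le_inner hx
      _ ≤ ‖x‖ * ‖gram H x‖ := real_inner_le_norm _ _
      _ = _ := mul_comm _ _
  exact le_of_mul_le_mul_right h1 (norm_pos_iff.2 h0)

theorem gram_apply_mem_orthogonal_U0 (H : Op K L) (x : EuclideanSpace ℝ (Fin L)) :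
    gram H x ∈ (U0 H)ᗮ := by
  rw [Submodule.mem_orthogonal]
  intro y hy
  rw [← inner_gram_comm, mem_U0.1 hy, inner_zero_left]

theorem P0perp_eq_starProjection (H : Op K L) : P0perp H = (U0 H)ᗮ.starProjection := by
  rw [Submodule.starProjection_orthogonal]
  rfl

/-- An orthogonal projection is determined by `X x` lying in the subspace and `x - X x` in its
complement, here the kernel of `gram H`. -/
theorem eq_P0perp_of_gram_comp {H : Op K L} {X : Op L L} (hr : ∀ x, X x ∈ (U0 H)ᗮ)
    (hk : gram H ∘L X = gram H) : X = P0perp H := by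
  ext1 x
  rw [P0perp_eq_starProjection]
  refine (Submodule.eq_starProjection_of_mem_orthogonal (hr x) ?_).symm
  rw [Submodule.orthogonal_orthogonal, mem_U0, map_sub, sub_eq_zero]
  exact (congrArg (fun S : Op L L => S x) hk).symm

end Gram

/-! ### The pseudoinverse `S0` and its norm -/

section Pseudoinverse

variable {K L : ℕ} (H : Op K L)

theorem S0_comp_gram : S0 H ∘L gram H = P0perp H := by
  have h := pinv_spec (gram H)
  refine eq_P0perp_of_gram_comp (fun x => ?_) h.mul_mul_self
  have h1 : S0 H ∘L gram H = gram H ∘L tr (S0 H) := by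
    rw [S0, ← h.right_symm, tr, ContinuousLinearMap.adjoint_comp]
    exact congrArg (· ∘L _) (tr_gram H)
  rw [h1]
  exact gram_apply_mem_orthogonal_U0 H _

theorem gram_comp_S0 : gram H ∘L S0 H = P0perp H := by
  have h := pinv_spec (gram H)
  refine eq_P0perp_of_gram_comp (fun x => gram_apply_mem_orthogonal_U0 H _) ?_
  have h1 : gram H ∘L S0 H = tr (S0 H) ∘L gram H := by
    rw [S0, ← h.left_symm, tr, ContinuousLinearMap.adjoint_comp]
    exact congrArg (_ ∘L ·) (tr_gram H)
  -- Symmetry of `S0 H` is not available here; transposing the first Penrose equation shows that `tr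
  -- (S0 H)` satisfies it too.
  have h2 : tr (gram H ∘L S0 H ∘L gram H) = gram H := by
    rw [S0, h.mul_mul_self, tr_gram]
  have h3 : tr (gram H ∘L S0 H ∘L gram H) = gram H ∘L tr (S0 H) ∘L gram H := by
    have h4 : ContinuousLinearMap.adjoint (gram H) = gram H := tr_gram H
    rw [tr, ContinuousLinearMap.adjoint_comp, ContinuousLinearMap.adjoint_comp, h4]
    rfl
  rw [h1, ← h3, h2]

theorem P0perp_comp_S0 : P0perp H ∘L S0 H = S0 H := by
  rw [← S0_comp_gram]
  exact (pinv_spec (gram H)).self_mul_mul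

theorem S0_comp_P0perp : S0 H ∘L P0perp H = S0 H := by
  rw [← gram_comp_S0]
  exact (pinv_spec (gram H)).self_mul_mul

theorem gram_comp_P0 : gram H ∘L P0 H = 0 := by
  ext1 x
  exact mem_U0.1 (Submodule.starProjection_apply_mem _ x)

theorem P0_comp_gram : P0 H ∘L gram H = 0 := by
  ext1 x
  exact ((U0 H).starProjection_apply_eq_zero_iff).2 (gram_apply_mem_orthogonal_U0 H x)

/-- `S0 H x` lies in the complement of the kernel, where `gram H` stretches by at least `muMin H`,
and its image there is a projection of `x`. -/
theorem norm_S0_le {H : Op K L} (hH : H ≠ 0) : ‖S0 H‖ ≤ 1 / muMin H := by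
  have hμ := muMin_pos hH
  refine (S0 H).opNorm_le_bound (by positivity) fun x => ?_
  have h1 : S0 H x ∈ (U0 H)ᗮ := by
    rw [← P0perp_comp_S0, P0perp_eq_starProjection]
    exact Submodule.starProjection_apply_mem _ _
  have h2 : ‖gram H (S0 H x)‖ ≤ ‖x‖ := by
    have h3 : gram H (S0 H x) = (U0 H)ᗮ.starProjection x := by
      rw [← P0perp_eq_starProjection, ← gram_comp_S0]
      rfl
    rw [h3]
    exact (U0 H)ᗮ.norm_starProjection_apply_le x
  rw [one_div, ← div_eq_inv_mul, le_div_iff₀ hμ, mul_comm]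
  exact (muMin_mul_norm_le h1).trans h2

end Pseudoinverse

/-! ### Eigenvalue bounds of Weyl type -/

section Weyl

variable {K L : ℕ} {H : Op K L} {V : Op L L}
  {u : OrthonormalBasis (Fin L) ℝ (EuclideanSpace ℝ (Fin L))} {ev : Fin L → ℝ}

theorem abs_inner_apply_self_le (V : Op L L) (x : EuclideanSpace ℝ (Fin L)) :
    |⟪x, V x⟫_ℝ| ≤ ‖V‖ * ‖x‖ ^ 2 :=
  calc |⟪x, V x⟫_ℝ| ≤ ‖x‖ * ‖V x‖ := abs_real_inner_le_norm _ _
    _ ≤ ‖x‖ * (‖V‖ * ‖x‖) := by gcongr; exact V.le_opNorm x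
    _ = _ := by ring

theorem muMin_sub_le_eigenvalue (hev : Antitone ev)
    (hu : ∀ i, (gram H + V) (u i) = ev i • u i) {i : Fin L} (hi : (i : ℕ) < rank H) :
    muMin H - ‖V‖ ≤ ev i := by
  -- Dimensions `rank H` and `L - i` exceed `L` together, because `i < rank H`.
  obtain ⟨x, hx0, hxU, hxs⟩ := exists_ne_zero_mem_inf_span u (U0 H)ᗮ (Finset.Ici i) (by
    rw [finrank_orthogonal_U0, Fin.card_Ici]
    omega)
  have h1 := inner_apply_self_le_of_mem_span hu (m := ev i)
    (fun j hj => hev (by simpa using hj)) hxs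
  have h2 := muMin_mul_le_inner hxU
  have h3 := (abs_le.1 (abs_inner_apply_self_le V x)).1
  rw [add_apply, inner_add_right] at h1
  have h4 : 0 < ‖x‖ ^ 2 := by positivity
  exact le_of_mul_le_mul_right (by linarith) h4

theorem eigenvalue_le_norm (hev : Antitone ev)
    (hu : ∀ i, (gram H + V) (u i) = ev i • u i) {i : Fin L} (hi : rank H ≤ (i : ℕ)) :
    ev i ≤ ‖V‖ := by
  have hd := rank_add_finrank_U0 H
  -- Here the dimensions are `L - rank H` and `i + 1`.
  obtain ⟨x, hx0, hxU, hxs⟩ := exists_ne_zero_mem_inf_span u (U0 H) (Finset.Iic i) (by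
    rw [Fin.card_Iic]
    omega)
  have h1 := le_inner_apply_self_of_mem_span hu (m := ev i)
    (fun j hj => hev (by simpa using hj)) hxs
  have h3 := (abs_le.1 (abs_inner_apply_self_le V x)).2
  rw [add_apply, mem_U0.1 hxU, zero_add] at h1
  have h4 : 0 < ‖x‖ ^ 2 := by positivity
  exact le_of_mul_le_mul_right (h1.trans h3) h4

end Weyl

/-- The second-order estimate for the projector onto the leading eigenvectors. -/
theorem norm_leading_projection_sub_le {K L : ℕ} {H E : Op K L} (hH : H ≠ 0) {δ : ℝ}
    (hb : ‖B H E δ‖ < muMin H) {U : Submodule ℝ (EuclideanSpace ℝ (Fin L))}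
    (hU : IsLeadingEigenspan (gram (H + δ • E)) (rank H) U) :
    ‖U.starProjection - P0perp H - W1 H E δ‖ ≤
      2 * (‖B H E δ‖ / (muMin H - ‖B H E δ‖)) ^ 2 +
        4 * (‖B H E δ‖ / (muMin H - ‖B H E δ‖) * (‖B H E δ‖ / muMin H)) := by
  classical
  obtain ⟨u, ev, hev, hu, rfl⟩ := hU
  have hmul : ∀ (X Y : Op L L) (x), (X * Y) x = X (Y x) := fun _ _ _ => rfl
  -- Nonnegativity comes from the Gram form, before it is expanded as `gram H + B H E δ`; it turns
  -- the upper bound on trailing eigenvalues into a norm bound.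
  have hnn := eigenvalue_gram_nonneg hu
  rw [gram_add_smul] at hu
  set s : Set (Fin L) := {i | (i : ℕ) < rank H}
  set P' : Op L L := (Submodule.span ℝ (u '' s)).starProjection
  have hP' : ∀ i, P' (u i) = (if i ∈ s then (1 : ℝ) else 0) • u i := starProjection_span_apply s
  have hgap : 0 < muMin H - ‖B H E δ‖ := sub_pos.2 hb
  have hlow : ∀ i ∈ s, muMin H - ‖B H E δ‖ ≤ ev i := fun i hi => muMin_sub_le_eigenvalue hev hu hi
  -- `R` inverts the perturbed operator on the leading span and vanishes on its complement.
  obtain ⟨R, hR⟩ := exists_diagonal u fun i => if i ∈ s then (ev i)⁻¹ else 0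
  have hPP : P0perp H * P0perp H = P0perp H := by
    rw [P0perp_eq_starProjection]
    exact (U0 H)ᗮ.isIdempotentElem_starProjection
  have hW : W1 H E δ = P0 H * B H E δ * S0 H + S0 H * B H E δ * P0 H := rfl
  rw [hW]
  refine norm_projection_sub_first_order_le (G := gram H) (R := R) (Q' := 1 - P')
    (muMin_pos hH) hb le_rfl (sub_add_cancel _ _) (add_sub_cancel _ _) hPP
    (Submodule.isIdempotentElem_starProjection _) (Submodule.starProjection_norm_le _)
    ?_ (S0_comp_gram H) (gram_comp_S0 H) (P0perp_comp_S0 H) (S0_comp_P0perp H)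
    (P0_comp_gram H) (gram_comp_P0 H) (norm_S0_le hH) ?_ ?_ ?_ ?_ ?_
  · refine norm_le_of_diagonal (c := fun i => if i ∈ s then 0 else 1) zero_le_one (u := u)
      (fun i => ?_) fun i => ?_
    · by_cases hi : i ∈ s <;> simp [hP', hi]
    · by_cases hi : i ∈ s <;> simp [hi]
  · refine op_ext_of_basis (u := u) fun i => ?_
    rw [hmul, hmul, hP', hu, map_smul, map_smul,
      hu, hP', smul_comm]
  · refine norm_le_of_diagonal (c := fun i => if i ∈ s then 0 else ev i) (norm_nonneg _) (u := u)
      (fun i => ?_) fun i => ?_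
    · rw [hmul, sub_apply, hP', map_sub, map_smul,
        one_apply_eq_self, hu]
      by_cases hi : i ∈ s <;> simp [hi]
    · by_cases hi : i ∈ s
      · simp [hi]
      · simp only [if_neg hi, abs_of_nonneg (hnn i)]
        exact eigenvalue_le_norm hev hu (not_lt.1 hi)
  · refine op_ext_of_basis (u := u) fun i => ?_
    rw [hmul, hR, hP', map_smul, hu, smul_smul]
    by_cases hi : i ∈ s
    · rw [if_pos hi, if_pos hi, inv_mul_cancel₀ (hgap.trans_le (hlow i hi)).ne']
    · simp [hi]
  · refine op_ext_of_basis (u := u) fun i => ?_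
    rw [hmul, hu, hP', map_smul, hR, smul_smul]
    by_cases hi : i ∈ s
    · rw [if_pos hi, if_pos hi, mul_inv_cancel₀ (hgap.trans_le (hlow i hi)).ne']
    · simp [hi]
  · refine norm_le_of_diagonal (by positivity) hR fun i => ?_
    by_cases hi : i ∈ s
    · rw [if_pos hi, abs_of_nonneg (inv_nonneg.2 (hnn i)), one_div]
      exact inv_anti₀ hgap (hlow i hi)
    · rw [if_neg hi, abs_zero]
      positivity

end SignalSubspace

theorem theorem4 {K L : ℕ} (H E : SignalSubspace.Op K L) (hH : H ≠ 0) (hE : E ≠ 0)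
    (hrank : SignalSubspace.rank H < min L K)
    (δ₀ : ℝ) (hδ₀ : 0 < δ₀)
    (hB : ∀ δ ∈ Set.Ioo (-δ₀) δ₀,
      ‖SignalSubspace.B H E δ‖ / SignalSubspace.muMin H < 1 / 4)
    (δ : ℝ) (hδ : δ ∈ Set.Ioo (-δ₀) δ₀)
    (U : Submodule ℝ (EuclideanSpace ℝ (Fin L)))
    (hU : SignalSubspace.IsLeadingEigenspan (SignalSubspace.gram (H + δ • E))
      (SignalSubspace.rank H) U) :
    ‖U.starProjection - SignalSubspace.P0perp H - SignalSubspace.W1 H E δ‖ ≤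
      16 * (Real.exp (1 / 6) / Real.sqrt Real.pi) *
        (‖SignalSubspace.B H E δ‖ / SignalSubspace.muMin H) ^ 2 *
        (1 / (1 - 4 * (‖SignalSubspace.B H E δ‖ / SignalSubspace.muMin H))) := by
  have hμ := SignalSubspace.muMin_pos hH
  have hβ := hB δ hδ
  have hb : ‖SignalSubspace.B H E δ‖ < SignalSubspace.muMin H := by
    rw [div_lt_iff₀ hμ] at hβ
    linarith
  exact (SignalSubspace.norm_leading_projection_sub_le hH hb hU).trans
    (SignalSubspace.second_order_bound_le hμ (norm_nonneg _) hβ)
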